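/- Let $k$ be an algebraically closed field of characteristic $p>0$, let $n\ge 0$, and let $S=k[[x_1,\dots,x_n]]$. Let $G$ be a finite group scheme over $k$, with coordinate ring $A=H^0(G,\mathcal O_G)$, a finite-dimensional commutative Hopf algebra over $k$. Let $G$ act on $\operatorname{Spec} S$ over $k$, and let $R=S^G\subseteq S$ be the subring of invariants. Assume that the action is free in codimension one: there is a closed subset $Z\subset\operatorname{Spec}S$ of codimension at least two whose complement $V$ is stable under $G$ and such that the morphism $$V\times_{\operatorname{Spec}k}G\longrightarrow V\times_{\operatorname{Spec}R}V,\qquad (v,g)\mapsto (v,gv),$$ is an isomorphism of schemes. Let $H=A^*$ be the dual Hopf algebra of $A$. The action, viewed as a right action through $v\cdot g=g^{-1}v$, makes $S$ a right $A$-comodule algebra, $s\mapsto\sum s_0\otimes s_1\in S\otimes_kA$, equivalently a left $H$-module algebra, $h\cdot s=\sum h(s_1)s_0$. Let $S*G:=S\#H$ be the smash product (the skew group scheme ring), that is, the vector space $S\otimes_kH$ with the multiplication $(s\#h)(t\#g)=\sum s\,(h_1\cdot t)\#h_2g$; it is an $R$-algebra via $r\mapsto r\#1$. Then $R$ is normal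 (an integrally closed domain), and the natural homomorphism of $R$-algebras $$S*G=S\#H\longrightarrow\operatorname{End}_R(S),\qquad s\#h\mapsto\bigl(t\mapsto s\,(h\cdot t)\bigr),$$ is an isomorphism. -/

import Mathlib

universe u

open TensorProduct

noncomputable section

/-! ### The dual Hopf algebra -/

/-- The linear dual `A →ₗ[k] k` of a Hopf algebra `A`. Its multiplication is the convolution
product `(f * g)(a) = ∑ f(a₁) g(a₂)`, and for `A` finite-dimensional and commutative it is made
into a Hopf algebra below. -/
def HopfDual (k A : Type*) [Field k] [CommRing A] [HopfAlgebra k A] : Type _ :=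
  Module.Dual k A

namespace HopfDual

section Ring

variable {k A : Type*} [Field k] [CommRing A] [HopfAlgebra k A]

instance instAddCommGroup : AddCommGroup (HopfDual k A) :=
  inferInstanceAs (AddCommGroup (Module.Dual k A))

instance instModule : Module k (HopfDual k A) :=
  inferInstanceAs (Module k (Module.Dual k A))

variable (k A) in
/-- The identification of `HopfDual k A` with the space of linear forms on `A`. -/
def toDual : HopfDual k A ≃ₗ[k] Module.Dual k A := LinearEquiv.refl k (Module.Dual k A)

instance instMul : Mul (HopfDual k A) where
  mul f g := (toDual k A).symm (LinearMap.mul' k k ∘ₗ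
    TensorProduct.map (toDual k A f) (toDual k A g) ∘ₗ Coalgebra.comul)

instance instOne : One (HopfDual k A) where
  one := (toDual k A).symm Coalgebra.counit

/-- The comparison with Mathlib's convolution ring. -/
def toConv (f : HopfDual k A) : WithConv (A →ₗ[k] k) := WithConv.toConv (toDual k A f)

theorem toConv_injective : Function.Injective (toConv (k := k) (A := A)) :=
  fun _ _ h => (toDual k A).injective (WithConv.toConv_injective h)

theorem toConv_mul (f g : HopfDual k A) : (f * g).toConv = f.toConv * g.toConv := rfl

theorem toConv_one : (1 : HopfDual k A).toConv = 1 := rfl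

theorem toConv_add (f g : HopfDual k A) : (f + g).toConv = f.toConv + g.toConv := rfl

theorem toConv_zero : (0 : HopfDual k A).toConv = 0 := rfl

theorem toConv_smul (c : k) (f : HopfDual k A) : (c • f).toConv = c • f.toConv := rfl

instance instRing : Ring (HopfDual k A) where
  mul := (· * ·)
  one := 1
  zero_mul f := toConv_injective (zero_mul f.toConv)
  mul_zero f := toConv_injective (mul_zero f.toConv)
  one_mul f := toConv_injective (one_mul f.toConv)
  mul_one f := toConv_injective (mul_one f.toConv)
  mul_assoc f g h := toConv_injective (mul_assoc f.toConv g.toConv h.toConv)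
  left_distrib f g h := toConv_injective (left_distrib f.toConv g.toConv h.toConv)
  right_distrib f g h := toConv_injective (right_distrib f.toConv g.toConv h.toConv)
  zsmul := fun n f => n • f
  neg_add_cancel := neg_add_cancel
  sub_eq_add_neg := sub_eq_add_neg
  zsmul_zero' := SubNegMonoid.zsmul_zero'
  zsmul_succ' := SubNegMonoid.zsmul_succ'
  zsmul_neg' := SubNegMonoid.zsmul_neg'

instance instAlgebra : Algebra k (HopfDual k A) :=
  Algebra.ofModule
    (fun c f g => toConv_injective (smul_mul_assoc c f.toConv g.toConv))
    (fun c f g => toConv_injective (mul_smul_comm c f.toConv g.toConv))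

theorem toDual_mul {ι : Type*} (f g : HopfDual k A) {a : A} (r : Coalgebra.Repr k a ι) :
    toDual k A (f * g) a =
      ∑ i ∈ r.index, toDual k A f (r.left i) * toDual k A g (r.right i) :=
  r.convMul_apply (A := k) f.toConv g.toConv

@[simp] theorem toDual_one (a : A) :
    toDual k A 1 a = Coalgebra.counit (R := k) a := rfl

theorem ext_toDual {f g : HopfDual k A} (h : ∀ a, toDual k A f a = toDual k A g a) : f = g :=
  (toDual k A).injective (LinearMap.ext h)

variable (k A) in
/-- The counit of the dual: evaluation at `1`. -/
def counitMap : HopfDual k A →ₗ[k] k :=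
  LinearMap.applyₗ (1 : A) ∘ₗ (toDual k A).toLinearMap

theorem counitMap_apply (f : HopfDual k A) : counitMap k A f = toDual k A f 1 := rfl

variable (k A) in
/-- The antipode of the dual: the transpose of the antipode of `A`. -/
def antipodeMap : HopfDual k A →ₗ[k] HopfDual k A :=
  (toDual k A).symm.toLinearMap ∘ₗ (HopfAlgebra.antipode k (A := A)).dualMap ∘ₗ
    (toDual k A).toLinearMap

@[simp] theorem toDual_antipodeMap (f : HopfDual k A) (a : A) :
    toDual k A (antipodeMap k A f) a = toDual k A f (HopfAlgebra.antipode k a) := by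
  simp [antipodeMap]

end Ring

section Finite

variable {k A : Type*} [Field k] [CommRing A] [HopfAlgebra k A] [Module.Finite k A]

variable (k A) in
/-- The identification `H ⊗ H = (A ⊗ A)^*` for the dual `H` of a finite-dimensional `A`, given by
`(f ⊗ g)(a ⊗ b) = f(a) g(b)`. -/
def pairing : HopfDual k A ⊗[k] HopfDual k A ≃ₗ[k] Module.Dual k (A ⊗[k] A) :=
  (TensorProduct.congr (toDual k A) (toDual k A)).trans (dualDistribEquiv k A A)

@[simp] theorem pairing_tmul (f g : HopfDual k A) (a b : A) :
    pairing k A (f ⊗ₜ g) (a ⊗ₜ b) = toDual k A f a * toDual k A g b := by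
  simp [pairing, dualDistribEquiv, dualDistribEquivOfBasis]

theorem ext_pairing {x y : HopfDual k A ⊗[k] HopfDual k A}
    (h : ∀ a b : A, pairing k A x (a ⊗ₜ b) = pairing k A y (a ⊗ₜ b)) : x = y :=
  (pairing k A).injective (TensorProduct.ext' h)

variable (k A) in
/-- The identification `H ⊗ (H ⊗ H) = (A ⊗ (A ⊗ A))^*`. -/
def pairing₃ : HopfDual k A ⊗[k] (HopfDual k A ⊗[k] HopfDual k A) ≃ₗ[k]
    Module.Dual k (A ⊗[k] (A ⊗[k] A)) :=
  (TensorProduct.congr (toDual k A) (pairing k A)).trans (dualDistribEquiv k A (A ⊗[k] A))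

theorem pairing₃_tmul (f : HopfDual k A) (x : HopfDual k A ⊗[k] HopfDual k A) (a : A)
    (z : A ⊗[k] A) : pairing₃ k A (f ⊗ₜ x) (a ⊗ₜ z) = toDual k A f a * pairing k A x z := by
  simp [pairing₃, dualDistribEquiv, dualDistribEquivOfBasis]

theorem pairing₃_assoc_tmul (x : HopfDual k A ⊗[k] HopfDual k A) (h : HopfDual k A) (a b c : A) :
    pairing₃ k A (TensorProduct.assoc k _ _ _ (x ⊗ₜ h)) (a ⊗ₜ (b ⊗ₜ c)) =
      pairing k A x (a ⊗ₜ b) * toDual k A h c := by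
  induction x with
  | zero => simp
  | tmul f g => simp [pairing₃_tmul, mul_assoc]
  | add x y hx hy => simp only [add_tmul, map_add, LinearMap.add_apply, hx, hy, add_mul]

variable (k A) in
/-- The comultiplication of the dual: the transpose of the multiplication of `A`, that is,
`f(a b) = ∑ f₁(a) f₂(b)`. -/
def comulMap : HopfDual k A →ₗ[k] HopfDual k A ⊗[k] HopfDual k A :=
  (pairing k A).symm.toLinearMap ∘ₗ (LinearMap.mul' k A).dualMap ∘ₗ (toDual k A).toLinearMap

@[simp] theorem pairing_comulMap (f : HopfDual k A) (a b : A) :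
    pairing k A (comulMap k A f) (a ⊗ₜ b) = toDual k A f (a * b) := by
  simp [comulMap]

instance instCoalgebra : Coalgebra k (HopfDual k A) where
  comul := comulMap k A
  counit := counitMap k A
  coassoc := by
    ext f : 1
    simp only [LinearMap.comp_apply]
    apply (pairing₃ k A).injective
    ext a b c
    have h1 : ∀ x : HopfDual k A ⊗[k] HopfDual k A, pairing₃ k A (TensorProduct.assoc k _ _ _
        ((comulMap k A).rTensor _ x)) (a ⊗ₜ (b ⊗ₜ c)) = pairing k A x ((a * b) ⊗ₜ c) := by
      intro x
      induction x with
      | zero => simp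
      | tmul f g => simp [pairing₃_assoc_tmul]
      | add x y hx hy => simp only [map_add, LinearMap.add_apply, hx, hy]
    have h2 : ∀ x : HopfDual k A ⊗[k] HopfDual k A, pairing₃ k A
        ((comulMap k A).lTensor _ x) (a ⊗ₜ (b ⊗ₜ c)) = pairing k A x (a ⊗ₜ (b * c)) := by
      intro x
      induction x with
      | zero => simp
      | tmul f g => simp [pairing₃_tmul]
      | add x y hx hy => simp only [map_add, LinearMap.add_apply, hx, hy]
    have h3 := h1 (comulMap k A f)
    have h4 := h2 (comulMap k A f)
    simp only [pairing_comulMap, mul_assoc] at h3 h4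
    exact h3.trans h4.symm
  rTensor_counit_comp_comul := by
    ext f : 1
    apply (TensorProduct.lid k (HopfDual k A)).injective
    apply ext_toDual
    intro a
    have h1 : ∀ x : HopfDual k A ⊗[k] HopfDual k A,
        toDual k A (TensorProduct.lid k _ ((counitMap k A).rTensor _ x)) a =
        pairing k A x (1 ⊗ₜ a) := by
      intro x
      induction x with
      | zero => simp
      | tmul f g => simp [counitMap_apply]
      | add x y hx hy => simp only [map_add, LinearMap.add_apply, hx, hy]
    simpa using h1 (comulMap k A f)
  lTensor_counit_comp_comul := by
    ext f : 1
    apply (TensorProduct.rid k (HopfDual k A)).injective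
    apply ext_toDual
    intro a
    have h1 : ∀ x : HopfDual k A ⊗[k] HopfDual k A,
        toDual k A (TensorProduct.rid k _ ((counitMap k A).lTensor _ x)) a =
        pairing k A x (a ⊗ₜ 1) := by
      intro x
      induction x with
      | zero => simp
      | tmul f g => simp [counitMap_apply, mul_comm]
      | add x y hx hy => simp only [map_add, LinearMap.add_apply, hx, hy]
    simpa using h1 (comulMap k A f)

@[simp] theorem pairing_comul (f : HopfDual k A) (a b : A) :
    pairing k A (Coalgebra.comul f) (a ⊗ₜ b) = toDual k A f (a * b) := pairing_comulMap f a b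

theorem counit_apply (f : HopfDual k A) : Coalgebra.counit (R := k) f = toDual k A f 1 := rfl

theorem pairing_mul {ι κ : Type*} (x y : HopfDual k A ⊗[k] HopfDual k A) {a b : A}
    (ra : Coalgebra.Repr k a ι) (rb : Coalgebra.Repr k b κ) :
    pairing k A (x * y) (a ⊗ₜ b) =
    ∑ i ∈ ra.index, ∑ j ∈ rb.index, pairing k A x (ra.left i ⊗ₜ rb.left j) *
      pairing k A y (ra.right i ⊗ₜ rb.right j) := by
  induction x with
  | zero => simp
  | add x y hx hy =>
    simp only [add_mul, map_add, LinearMap.add_apply, hx, hy, Finset.sum_add_distrib]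
  | tmul f g =>
    induction y with
    | zero => simp
    | add x y hx hy =>
      simp only [mul_add, map_add, LinearMap.add_apply, hx, hy, Finset.sum_add_distrib]
    | tmul f' g' =>
      rw [Algebra.TensorProduct.tmul_mul_tmul, pairing_tmul, toDual_mul _ _ ra,
        toDual_mul _ _ rb, Finset.sum_mul_sum]
      refine Finset.sum_congr rfl fun i _ => Finset.sum_congr rfl fun j _ => ?_
      rw [pairing_tmul, pairing_tmul]
      ring

open Coalgebra in
instance instBialgebra : Bialgebra k (HopfDual k A) := Bialgebra.mk' k _
  (by simp [counit_apply])
  (by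
    intro f g
    have h := pairing_mul (f ⊗ₜ[k] (1 : HopfDual k A)) (g ⊗ₜ[k] (1 : HopfDual k A))
      (a := 1) (b := 1)
      { index := {()}, left := fun _ => 1, right := fun _ => 1,
        eq := by simp [Bialgebra.comul_one, Algebra.TensorProduct.one_def] }
      { index := {()}, left := fun _ => 1, right := fun _ => 1,
        eq := by simp [Bialgebra.comul_one, Algebra.TensorProduct.one_def] }
    simpa [counit_apply] using h)
  (by
    apply ext_pairing
    intro a b
    rw [pairing_comul, Algebra.TensorProduct.one_def, pairing_tmul]
    simp)
  (by
    intro f g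
    apply ext_pairing
    intro a b
    rw [pairing_comul, pairing_mul _ _ (ℛ k a) (ℛ k b),
      toDual_mul _ _ ((ℛ k a).mul (ℛ k b))]
    simp [Finset.sum_product])

open Coalgebra in
/-- The dual Hopf algebra of a finite-dimensional commutative Hopf algebra. -/
instance instHopfAlgebra : HopfAlgebra k (HopfDual k A) where
  antipode := antipodeMap k A
  mul_antipode_rTensor_comul := by
    ext f : 1
    apply ext_toDual
    intro a
    have h1 : ∀ x : HopfDual k A ⊗[k] HopfDual k A,
        toDual k A (LinearMap.mul' k _ ((antipodeMap k A).rTensor _ x)) a =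
        ∑ i ∈ (ℛ k a).index, pairing k A x
          (HopfAlgebra.antipode k ((ℛ k a).left i) ⊗ₜ (ℛ k a).right i) := by
      intro x
      induction x with
      | zero => simp
      | tmul f g => simp [toDual_mul _ _ (ℛ k a)]
      | add x y hx hy =>
        simp only [map_add, LinearMap.add_apply, hx, hy, Finset.sum_add_distrib]
    simp only [LinearMap.comp_apply]
    rw [h1]
    simp only [pairing_comul]
    rw [← map_sum, HopfAlgebra.sum_antipode_mul_eq_smul, Algebra.linearMap_apply,
      Algebra.algebraMap_eq_smul_one, counit_apply, map_smul, map_smul]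
    simp [mul_comm]
  mul_antipode_lTensor_comul := by
    ext f : 1
    apply ext_toDual
    intro a
    have h1 : ∀ x : HopfDual k A ⊗[k] HopfDual k A,
        toDual k A (LinearMap.mul' k _ ((antipodeMap k A).lTensor _ x)) a =
        ∑ i ∈ (ℛ k a).index, pairing k A x
          ((ℛ k a).left i ⊗ₜ HopfAlgebra.antipode k ((ℛ k a).right i)) := by
      intro x
      induction x with
      | zero => simp
      | tmul f g => simp [toDual_mul _ _ (ℛ k a)]
      | add x y hx hy =>
        simp only [map_add, LinearMap.add_apply, hx, hy, Finset.sum_add_distrib]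
    simp only [LinearMap.comp_apply]
    rw [h1]
    simp only [pairing_comul]
    rw [← map_sum, HopfAlgebra.sum_mul_antipode_eq_smul, Algebra.linearMap_apply,
      Algebra.algebraMap_eq_smul_one, counit_apply, map_smul, map_smul]
    simp [mul_comm]

end Finite

end HopfDual

/-! ### Module algebras and smash products -/

/-- A left `H`-module algebra structure on the `k`-algebra `S`: an action of the algebra `H` on the
vector space `S` such that `h (s t) = ∑ (h₁ s) (h₂ t)` and `h 1 = ε(h) 1`. -/
structure ModuleAlgebra (k H S : Type*) [CommRing k] [Ring H] [Bialgebra k H] [Ring S]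
    [Algebra k S] where
  /-- The action of `H` on `S`. -/
  act : H →ₐ[k] Module.End k S
  act_mul : ∀ (h : H) (s t : S), act h (s * t) =
    LinearMap.mul' k S (TensorProduct.map (act.toLinearMap.flip s) (act.toLinearMap.flip t)
      (Coalgebra.comul (R := k) h))
  act_one : ∀ h : H, act h 1 = algebraMap k S (Coalgebra.counit h)

namespace ModuleAlgebra

variable {k H S : Type*} [CommRing k] [Ring H] [Bialgebra k H] [Ring S] [Algebra k S]

theorem act_mul_repr {ι : Type*} (M : ModuleAlgebra k H S) {h : H} (r : Coalgebra.Repr k h ι)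
    (s t : S) : M.act h (s * t) = ∑ i ∈ r.index, M.act (r.left i) s * M.act (r.right i) t := by
  rw [M.act_mul, ← r.eq]
  simp

/-- The smash product `S # H` of the `H`-module algebra `S` with `H`: the vector space `S ⊗ H` with
the multiplication `(s # h) (t # g) = ∑ s (h₁ t) # h₂ g`, see `SmashProduct.smash_mul_smash`. -/
def SmashProduct (_M : ModuleAlgebra k H S) : Type _ := S ⊗[k] H

namespace SmashProduct

variable (M : ModuleAlgebra k H S)

instance instAddCommGroup : AddCommGroup M.SmashProduct :=
  inferInstanceAs (AddCommGroup (S ⊗[k] H))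

instance instModule : Module k M.SmashProduct := inferInstanceAs (Module k (S ⊗[k] H))

/-- The identification of the vector space underlying `S # H` with `S ⊗ H`. -/
def toTensor : M.SmashProduct ≃ₗ[k] S ⊗[k] H := LinearEquiv.refl k (S ⊗[k] H)

/-- The element `s # h` of the smash product. -/
def smash (s : S) (h : H) : M.SmashProduct := (toTensor M).symm (s ⊗ₜ h)

/-- The action of `h` on the tensor product of the two `H`-modules `S` and `H`, that is,
`t ⊗ g ↦ ∑ h₁ t ⊗ h₂ g`. -/
def diag : H →ₗ[k] Module.End k (S ⊗[k] H) :=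
  TensorProduct.homTensorHomMap (.id k) S H S H ∘ₗ
    TensorProduct.map M.act.toLinearMap (LinearMap.mul k H) ∘ₗ Coalgebra.comul

theorem diag_apply {ι : Type*} {h : H} (r : Coalgebra.Repr k h ι) (t : S) (g : H) :
    diag M h (t ⊗ₜ g) = ∑ i ∈ r.index, M.act (r.left i) t ⊗ₜ (r.right i * g) := by
  rw [diag, LinearMap.comp_apply, LinearMap.comp_apply, ← r.eq]
  simp

/-- Left multiplication by the elements of `S # H`, as linear endomorphisms of `S ⊗ H`. -/
def lmul : S ⊗[k] H →ₗ[k] Module.End k (S ⊗[k] H) :=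
  TensorProduct.lift
    ((LinearMap.mul k (Module.End k (S ⊗[k] H))).compl₁₂
      ((LinearMap.rTensorHom H) ∘ₗ LinearMap.mul k S) (diag M))

theorem lmul_tmul (s : S) (h : H) :
    lmul M (s ⊗ₜ h) = (LinearMap.mulLeft k s).rTensor H * diag M h := by
  rfl

theorem lmul_tmul_tmul {ι : Type*} (s t : S) {h : H} (g : H) (r : Coalgebra.Repr k h ι) :
    lmul M (s ⊗ₜ h) (t ⊗ₜ g) = ∑ i ∈ r.index, (s * M.act (r.left i) t) ⊗ₜ (r.right i * g) := by
  rw [lmul_tmul, Module.End.mul_apply, diag_apply M r]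
  simp

theorem diag_mul (h g : H) : diag M (h * g) = diag M h * diag M g := by
  apply TensorProduct.ext'
  intro t f
  rw [diag_apply M ((Coalgebra.Repr.arbitrary k h).mul (Coalgebra.Repr.arbitrary k g)),
    Module.End.mul_apply, diag_apply M (Coalgebra.Repr.arbitrary k g), map_sum]
  simp only [diag_apply M (Coalgebra.Repr.arbitrary k h)]
  simp [Finset.sum_product, mul_assoc]
  exact Finset.sum_comm

theorem lmul_one : lmul M (1 ⊗ₜ 1) = 1 := by
  apply TensorProduct.ext'
  intro t g
  let r : Coalgebra.Repr k (1 : H) Unit :=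
    { index := {()}
      left := fun _ => 1
      right := fun _ => 1
      eq := by simp [Bialgebra.comul_one, Algebra.TensorProduct.one_def] }
  rw [lmul_tmul_tmul M 1 t g r]
  simp [r]

theorem lmul_apply_one (x : S ⊗[k] H) : lmul M x (1 ⊗ₜ 1) = x := by
  induction x with
  | zero => simp
  | add x y hx hy => simp only [map_add, LinearMap.add_apply, hx, hy]
  | tmul s h =>
    rw [lmul_tmul_tmul M s 1 1 (Coalgebra.Repr.arbitrary k h)]
    simp only [M.act_one, mul_one, ← Algebra.commutes, ← Algebra.smul_def,
      TensorProduct.smul_tmul]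
    rw [← TensorProduct.tmul_sum, Coalgebra.sum_counit_smul]

theorem diag_mulLeft (h : H) (t : S) :
    diag M h * (LinearMap.mulLeft k t).rTensor H = lmul M (diag M h (t ⊗ₜ 1)) := by
  apply TensorProduct.ext'
  intro u f
  set r := Coalgebra.Repr.arbitrary k h with hr
  let a₁ := fun i => Coalgebra.Repr.arbitrary k (r.left i)
  let a₂ := fun i => Coalgebra.Repr.arbitrary k (r.right i)
  have key := congrArg (TensorProduct.map (LinearMap.mul' k S) (LinearMap.id (R := k) (M := H)) ∘ₗ
    (TensorProduct.assoc k S S H).symm.toLinearMap ∘ₗ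
    TensorProduct.map (M.act.toLinearMap.flip t)
      (TensorProduct.map (M.act.toLinearMap.flip u) (LinearMap.mulRight k f)))
    (Coalgebra.sum_tmul_tmul_eq r a₁ a₂)
  simp only [map_sum, LinearMap.comp_apply, TensorProduct.map_tmul] at key
  rw [Module.End.mul_apply, LinearMap.rTensor_tmul, LinearMap.mulLeft_apply, diag_apply M r,
    diag_apply M r, map_sum, LinearMap.sum_apply]
  simp only [mul_one, M.act_mul_repr (a₁ _)]
  have : ∀ i, lmul M (M.act (r.left i) t ⊗ₜ r.right i) (u ⊗ₜ f) = _ := fun i =>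
    lmul_tmul_tmul M (M.act (r.left i) t) u f (a₂ i)
  simp only [this, TensorProduct.sum_tmul]
  simpa using key

theorem lmul_lmul (x y : S ⊗[k] H) : lmul M (lmul M x y) = lmul M x * lmul M y := by
  induction x with
  | zero => simp
  | add x x' hx hx' => simp only [map_add, LinearMap.add_apply, hx, hx', add_mul]
  | tmul s h =>
    induction y with
    | zero => simp
    | add y y' hy hy' => simp only [map_add, hy, hy', mul_add]
    | tmul t g =>
      have h1 : ∀ (s t : S) (x : S ⊗[k] H),
          lmul M ((LinearMap.mulLeft k s).rTensor H x) =
            (LinearMap.mulLeft k s).rTensor H * lmul M x := by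
        intro s t x
        induction x with
        | zero => simp
        | add x x' hx hx' => simp only [map_add, hx, hx', mul_add]
        | tmul u f =>
          rw [LinearMap.rTensor_tmul, lmul_tmul, lmul_tmul, ← mul_assoc, LinearMap.mulLeft_apply,
            LinearMap.mulLeft_mul, Module.End.mul_eq_comp _ _, LinearMap.rTensor_comp]
          rfl
      have h2 : ∀ (x : S ⊗[k] H), lmul M ((LinearMap.mulRight k g).lTensor S x) =
          lmul M x * diag M g := by
        intro x
        induction x with
        | zero => simp
        | add x x' hx hx' => simp only [map_add, hx, hx', add_mul]
        | tmul u f =>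
          rw [LinearMap.lTensor_tmul, lmul_tmul, lmul_tmul, LinearMap.mulRight_apply, diag_mul,
            mul_assoc]
      have h3 : diag M h (t ⊗ₜ g) = (LinearMap.mulRight k g).lTensor S (diag M h (t ⊗ₜ 1)) := by
        rw [diag_apply M (Coalgebra.Repr.arbitrary k h), diag_apply M (Coalgebra.Repr.arbitrary k h)]
        simp
      rw [lmul_tmul M s h, lmul_tmul M t g, Module.End.mul_apply, h1 s t, h3, h2, ← diag_mulLeft,
        mul_assoc, mul_assoc]

instance instMul : Mul M.SmashProduct where
  mul x y := (toTensor M).symm (lmul M (toTensor M x) (toTensor M y))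

instance instOne : One M.SmashProduct where
  one := smash M 1 1

variable {M}

theorem toTensor_mul (x y : M.SmashProduct) :
    toTensor M (x * y) = lmul M (toTensor M x) (toTensor M y) := rfl

theorem toTensor_one : toTensor M 1 = 1 ⊗ₜ 1 := rfl

instance instRing : Ring M.SmashProduct where
  mul := (· * ·)
  one := 1
  zero_mul x := (toTensor M).injective (by simp [toTensor_mul])
  mul_zero x := (toTensor M).injective (by simp [toTensor_mul])
  one_mul x := (toTensor M).injective (by simp [toTensor_mul, toTensor_one, lmul_one])
  mul_one x := (toTensor M).injective (by simp [toTensor_mul, toTensor_one, lmul_apply_one])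
  mul_assoc x y z := (toTensor M).injective (by simp [toTensor_mul, lmul_lmul])
  left_distrib x y z := (toTensor M).injective (by simp [toTensor_mul])
  right_distrib x y z := (toTensor M).injective (by simp [toTensor_mul])
  zsmul := fun n f => n • f
  neg_add_cancel := neg_add_cancel
  sub_eq_add_neg := sub_eq_add_neg
  zsmul_zero' := SubNegMonoid.zsmul_zero'
  zsmul_succ' := SubNegMonoid.zsmul_succ'
  zsmul_neg' := SubNegMonoid.zsmul_neg'

theorem smash_mul_smash {ι : Type*} (s t : S) {h : H} (g : H) (r : Coalgebra.Repr k h ι) :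
    smash M s h * smash M t g = ∑ i ∈ r.index, smash M (s * M.act (r.left i) t) (r.right i * g) := by
  apply (toTensor M).injective
  simp [toTensor_mul, smash, lmul_tmul_tmul M s t g r]

theorem induction_on {p : M.SmashProduct → Prop} (x : M.SmashProduct) (h0 : p 0)
    (hsmash : ∀ s h, p (smash M s h)) (hadd : ∀ x y, p x → p y → p (x + y)) : p x :=
  TensorProduct.induction_on (motive := fun x => p ((toTensor M).symm x)) (toTensor M x) h0
    hsmash (fun _ _ hx hy => hadd _ _ hx hy)

variable (M) in
/-- The linear map `S # H → End_k(S)` given by `s # h ↦ (t ↦ s (h t))`. -/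
def toEndLinear : M.SmashProduct →ₗ[k] Module.End k S :=
  TensorProduct.lift ((LinearMap.mul k (Module.End k S)).compl₁₂ (LinearMap.mul k S)
    M.act.toLinearMap) ∘ₗ (toTensor M).toLinearMap

@[simp] theorem toEndLinear_smash (s : S) (h : H) (t : S) :
    toEndLinear M (smash M s h) t = s * M.act h t := rfl

theorem toEndLinear_one : toEndLinear M 1 = 1 := by
  ext t
  simp [show (1 : M.SmashProduct) = smash M 1 1 from rfl]

theorem toEndLinear_mul (x y : M.SmashProduct) :
    toEndLinear M (x * y) = toEndLinear M x * toEndLinear M y := by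
  induction x using induction_on with
  | h0 => simp
  | hadd x x' hx hx' => simp only [add_mul, map_add, hx, hx']
  | hsmash s h =>
    induction y using induction_on with
    | h0 => simp
    | hadd y y' hy hy' => simp only [mul_add, map_add, hy, hy']
    | hsmash t g =>
      ext u
      rw [smash_mul_smash s t g (Coalgebra.Repr.arbitrary k h), map_sum, LinearMap.sum_apply,
        Module.End.mul_apply, toEndLinear_smash, toEndLinear_smash,
        M.act_mul_repr (Coalgebra.Repr.arbitrary k h), Finset.mul_sum]
      simp [mul_assoc]

end SmashProduct

end ModuleAlgebra

/-! ### Actions of finite group schemes -/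

/-- An action of the finite group scheme `G = Spec A` over `k` on `Spec S`, given by the
corresponding right coaction of the Hopf algebra `A = H⁰(G, 𝒪_G)`: a homomorphism of `k`-algebras
`S → S ⊗ A` that is coassociative and counital. It corresponds to the morphism
`Spec S × G → Spec S`, `(v, g) ↦ v g`; an action written on the left is viewed as one on the right
through `v g = g⁻¹ v`. -/
structure GroupSchemeAction (k A S : Type*) [Field k] [CommRing A] [HopfAlgebra k A]
    [CommRing S] [Algebra k S] where
  /-- The right coaction of the coordinate ring. -/
  coaction : S →ₐ[k] S ⊗[k] A
  coassoc : ∀ s : S, TensorProduct.assoc k S A A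
      (TensorProduct.map coaction.toLinearMap LinearMap.id (coaction s)) =
    TensorProduct.map LinearMap.id Coalgebra.comul (coaction s)
  counital : ∀ s : S, TensorProduct.rid k S
      (TensorProduct.map LinearMap.id Coalgebra.counit (coaction s)) = s

namespace GroupSchemeAction

section Defs

variable {k A S : Type*} [Field k] [CommRing A] [HopfAlgebra k A] [CommRing S] [Algebra k S]
  (α : GroupSchemeAction k A S)

/-- The ring of invariants `S^G`: the functions on `Spec S` whose pullbacks along the action
morphism and along the projection `Spec S × G → Spec S` agree. -/
def invariants : Subalgebra k S :=
  AlgHom.equalizer α.coaction Algebra.TensorProduct.includeLeft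

theorem mem_invariants {s : S} : s ∈ α.invariants ↔ α.coaction s = s ⊗ₜ 1 := Iff.rfl

/-- The homomorphism `S ⊗_R S → S ⊗_k A`, `s ⊗ t ↦ (s ⊗ 1) ρ(t)`, for `R = S^G` and the coaction
`ρ`. It corresponds to the morphism `Spec S × G → Spec S ×_{Spec R} Spec S`, `(v, g) ↦ (v, v g)`. -/
def galoisMap : S ⊗[α.invariants] S →+* S ⊗[k] A :=
  (Algebra.TensorProduct.productMap
    (Algebra.TensorProduct.includeLeft : S →ₐ[α.invariants] S ⊗[k] A)
    ({ α.coaction.toRingHom with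
        commutes' := fun r => r.2 } : S →ₐ[α.invariants] S ⊗[k] A)).toRingHom

@[simp] theorem galoisMap_tmul (s t : S) :
    α.galoisMap (s ⊗ₜ t) = (s ⊗ₜ 1) * α.coaction t := rfl

variable (k A S) in
/-- The map `S ⊗ A → S`, `s ⊗ a ↦ f(a) s`, for a linear form `f` on `A`. -/
def slice : HopfDual k A →ₗ[k] S ⊗[k] A →ₗ[k] S where
  toFun f := (TensorProduct.rid k S).toLinearMap ∘ₗ (HopfDual.toDual k A f).lTensor S
  map_add' f g := by simp [LinearMap.lTensor_add, LinearMap.comp_add]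
  map_smul' c f := by simp [LinearMap.lTensor_smul, LinearMap.comp_smul]

@[simp] theorem slice_tmul (f : HopfDual k A) (s : S) (a : A) :
    slice k A S f (s ⊗ₜ a) = HopfDual.toDual k A f a • s := by
  simp [slice]

/-- For a linear form `f` on `A`, the endomorphism `s ↦ ∑ f(s₁) s₀` of `S`, where
`ρ(s) = ∑ s₀ ⊗ s₁`. -/
def actLinear : HopfDual k A →ₗ[k] Module.End k S where
  toFun f := slice k A S f ∘ₗ α.coaction.toLinearMap
  map_add' f g := by simp [LinearMap.add_comp]
  map_smul' c f := by simp [LinearMap.smul_comp]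

theorem actLinear_apply (f : HopfDual k A) (s : S) :
    α.actLinear f s = slice k A S f (α.coaction s) := rfl

theorem actLinear_one : α.actLinear 1 = 1 := by
  ext s
  exact α.counital s

theorem actLinear_mul (f g : HopfDual k A) :
    α.actLinear (f * g) = α.actLinear f * α.actLinear g := by
  ext s
  have h1 : ∀ x : S ⊗[k] A, slice k A S f (α.coaction (slice k A S g x)) =
      TensorProduct.rid k S (TensorProduct.map LinearMap.id
        (LinearMap.mul' k k ∘ₗ TensorProduct.map (HopfDual.toDual k A f) (HopfDual.toDual k A g))
        (TensorProduct.assoc k S A A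
          (TensorProduct.map α.coaction.toLinearMap LinearMap.id x))) := by
    intro x
    induction x with
    | zero => simp
    | add x y hx hy => simp only [map_add, hx, hy]
    | tmul s a =>
      simp only [slice_tmul, map_smul, TensorProduct.map_tmul,
        LinearMap.id_apply, AlgHom.toLinearMap_apply]
      induction α.coaction s with
      | zero => simp
      | add x y hx hy => simp only [map_add, smul_add, hx, hy, TensorProduct.add_tmul]
      | tmul t b => simp [smul_smul, mul_comm]
  have h2 : ∀ x : S ⊗[k] A, TensorProduct.map LinearMap.id
        (LinearMap.mul' k k ∘ₗ TensorProduct.map (HopfDual.toDual k A f) (HopfDual.toDual k A g))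
        (TensorProduct.map LinearMap.id Coalgebra.comul x) =
      (HopfDual.toDual k A (f * g)).lTensor S x := by
    intro x
    induction x with
    | zero => simp
    | add x y hx hy => simp only [map_add, hx, hy]
    | tmul s a => rfl
  rw [Module.End.mul_apply, actLinear_apply, actLinear_apply, actLinear_apply, h1, α.coassoc, h2]
  rfl

end Defs

section Finite

variable {k A S : Type*} [Field k] [CommRing A] [HopfAlgebra k A] [Module.Finite k A]
  [CommRing S] [Algebra k S] (α : GroupSchemeAction k A S)

theorem slice_mul (f : HopfDual k A) (x y : S ⊗[k] A) : slice k A S f (x * y) =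
    LinearMap.mul' k S (TensorProduct.map ((slice k A S).flip x) ((slice k A S).flip y)
      (Coalgebra.comul (R := k) f)) := by
  induction x with
  | zero => simp
  | add x x' hx hx' =>
    simp only [add_mul, map_add, hx, hx', TensorProduct.map_add_left, LinearMap.add_apply]
  | tmul s a =>
    induction y with
    | zero => simp
    | add y y' hy hy' =>
      simp only [mul_add, map_add, hy, hy', TensorProduct.map_add_right, LinearMap.add_apply]
    | tmul t b =>
      have h : ∀ z : HopfDual k A ⊗[k] HopfDual k A, LinearMap.mul' k S (TensorProduct.map
          ((slice k A S).flip (s ⊗ₜ a)) ((slice k A S).flip (t ⊗ₜ b)) z) =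
          HopfDual.pairing k A z (a ⊗ₜ b) • (s * t) := by
        intro z
        induction z with
        | zero => simp
        | add z z' hz hz' => simp only [map_add, hz, hz', LinearMap.add_apply, add_smul]
        | tmul g g' => simp [smul_smul, mul_comm]
      rw [h, Algebra.TensorProduct.tmul_mul_tmul, slice_tmul, HopfDual.pairing_comul]

/-- The left module algebra structure on `S` over the dual Hopf algebra `H = A^*` given by a right
coaction of `A`, that is, `f s = ∑ f(s₁) s₀`. -/
def moduleAlgebra : ModuleAlgebra k (HopfDual k A) S where
  act := AlgHom.ofLinearMap α.actLinear α.actLinear_one α.actLinear_mul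
  act_mul f s t := by
    change slice k A S f (α.coaction (s * t)) = _
    rw [map_mul, slice_mul]
    rfl
  act_one f := by
    change slice k A S f (α.coaction 1) = _
    rw [map_one, Algebra.TensorProduct.one_def, slice_tmul, HopfDual.counit_apply,
      Algebra.algebraMap_eq_smul_one]

theorem moduleAlgebra_act (f : HopfDual k A) (s : S) :
    α.moduleAlgebra.act f s = slice k A S f (α.coaction s) := rfl

theorem act_invariant_mul (f : HopfDual k A) (r : α.invariants) (s : S) :
    α.moduleAlgebra.act f (r * s) = r * α.moduleAlgebra.act f s := by
  rw [moduleAlgebra_act, moduleAlgebra_act, map_mul, α.mem_invariants.1 r.2]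
  induction α.coaction s with
  | zero => simp
  | add x y hx hy => simp only [map_add, mul_add, hx, hy]
  | tmul t b => simp

/-- The skew group scheme ring `S * G = S # H`, where `H` is the dual Hopf algebra of
`A = H⁰(G, 𝒪_G)`. -/
abbrev SkewGroupSchemeRing : Type _ := α.moduleAlgebra.SmashProduct

open ModuleAlgebra SmashProduct

theorem smash_one_mul_smash (s t : S) (g : HopfDual k A) :
    smash α.moduleAlgebra s 1 * smash α.moduleAlgebra t g = smash α.moduleAlgebra (s * t) g := by
  let r : Coalgebra.Repr k (1 : HopfDual k A) Unit :=
    { index := {()}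
      left := fun _ => 1
      right := fun _ => 1
      eq := by simp [Bialgebra.comul_one, Algebra.TensorProduct.one_def] }
  rw [smash_mul_smash s t g r]
  simp [r]

theorem smash_mul_invariant (s : S) (h : HopfDual k A) (r : α.invariants) :
    smash α.moduleAlgebra s h * smash α.moduleAlgebra r 1 = smash α.moduleAlgebra (r * s) h := by
  rw [smash_mul_smash s r 1 (Coalgebra.Repr.arbitrary k h)]
  have h1 : ∀ f : HopfDual k A, α.moduleAlgebra.act f r = Coalgebra.counit (R := k) f • (r : S) := by
    intro f
    have := α.act_invariant_mul f r 1
    rwa [mul_one, α.moduleAlgebra.act_one, Algebra.algebraMap_eq_smul_one, mul_smul_comm,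
      mul_one] at this
  have h2 : ∀ f g : HopfDual k A, smash α.moduleAlgebra (s * Coalgebra.counit (R := k) f • (r : S)) g =
      smash α.moduleAlgebra (r * s) (Coalgebra.counit (R := k) f • g) := by
    intro f g
    rw [mul_smul_comm, mul_comm s]
    exact congrArg _ (TensorProduct.smul_tmul _ _ _)
  simp only [h1, h2, mul_one]
  conv_rhs => rw [← Coalgebra.sum_counit_smul (R := k) (Coalgebra.Repr.arbitrary k h)]
  simp only [smash, TensorProduct.tmul_sum, map_sum]

/-- The `S^G`-algebra structure of `S * G`, given by `r ↦ r # 1`. -/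
instance instAlgebraSkewGroupSchemeRing : Algebra α.invariants α.SkewGroupSchemeRing where
  algebraMap :=
    { toFun := fun r => smash α.moduleAlgebra r 1
      map_one' := rfl
      map_mul' := fun r s => (α.smash_one_mul_smash r s 1).symm
      map_zero' := by simp [smash]
      map_add' := fun r s => by simp [smash, TensorProduct.add_tmul] }
  smul r x := smash α.moduleAlgebra r 1 * x
  commutes' r x := by
    change smash α.moduleAlgebra r 1 * x = x * smash α.moduleAlgebra r 1
    induction x using induction_on with
    | h0 => simp
    | hadd x y hx hy => simp only [mul_add, add_mul, hx, hy]
    | hsmash s h => rw [smash_one_mul_smash, smash_mul_invariant]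
  smul_def' _ _ := rfl

/-- The natural homomorphism of `S^G`-algebras `S * G → End_{S^G}(S)`, which sends `s # h` to
`t ↦ s (h t)`. -/
def toEnd : α.SkewGroupSchemeRing →ₐ[α.invariants] Module.End α.invariants S where
  toFun x :=
    { toFun := toEndLinear α.moduleAlgebra x
      map_add' := map_add _
      map_smul' := fun r t => by
        change toEndLinear α.moduleAlgebra x (r * t) = r * toEndLinear α.moduleAlgebra x t
        induction x using induction_on with
        | h0 => simp
        | hadd x y hx hy => simp only [map_add, LinearMap.add_apply, mul_add, hx, hy]
        | hsmash s h => rw [toEndLinear_smash, toEndLinear_smash, act_invariant_mul, mul_left_comm] }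
  map_one' := by
    ext s
    exact LinearMap.congr_fun (toEndLinear_one (M := α.moduleAlgebra)) s
  map_mul' x y := by
    ext s
    exact LinearMap.congr_fun (toEndLinear_mul x y) s
  map_zero' := by
    ext s
    exact LinearMap.congr_fun (map_zero (toEndLinear α.moduleAlgebra)) s
  map_add' x y := by
    ext s
    exact LinearMap.congr_fun (map_add (toEndLinear α.moduleAlgebra) x y) s
  commutes' r := by
    ext t
    change toEndLinear α.moduleAlgebra (smash α.moduleAlgebra r 1) t = r * t
    simp

@[simp] theorem toEnd_smash (s : S) (h : HopfDual k A) (t : S) :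
    α.toEnd (smash α.moduleAlgebra s h) t = s * α.moduleAlgebra.act h t := rfl

end Finite

section Free

open AlgebraicGeometry

variable {k A S : Type u} [Field k] [CommRing A] [HopfAlgebra k A] [CommRing S] [Algebra k S]
  (α : GroupSchemeAction k A S)

/-- The action of `G` on `Spec S` is free in codimension one: there is an open subset `V` of `Spec S`
whose complement `Z` has codimension at least two (every prime of `S` in `Z` has height at least
two), which is stable under `G` (its preimages under the action morphism `a` and the projection `pr`
agree, so that there is an induced action on `V`), and such that
`V × G → V ×_{Spec R} V`, `(v, g) ↦ (v, v g)`, where `R = S^G`, is an isomorphism of schemes.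
Here `V ×_{Spec R} V` is the open subscheme `pr₁⁻¹(V) ∩ pr₂⁻¹(V)` of
`Spec S ×_{Spec R} Spec S = Spec (S ⊗_R S)`, and its preimage under `Ψ : (v, g) ↦ (v, v g)` is
`pr⁻¹(V) ∩ a⁻¹(V) = V × G`. -/
def FreeInCodimensionOne : Prop :=
  let a : Spec (.of (S ⊗[k] A)) ⟶ Spec (.of S) :=
    Spec.map (CommRingCat.ofHom α.coaction.toRingHom)
  let pr : Spec (.of (S ⊗[k] A)) ⟶ Spec (.of S) :=
    Spec.map (CommRingCat.ofHom Algebra.TensorProduct.includeLeftRingHom)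
  let pr₁ : Spec (.of (S ⊗[α.invariants] S)) ⟶ Spec (.of S) :=
    Spec.map (CommRingCat.ofHom Algebra.TensorProduct.includeLeftRingHom)
  let pr₂ : Spec (.of (S ⊗[α.invariants] S)) ⟶ Spec (.of S) :=
    Spec.map (CommRingCat.ofHom
      (Algebra.TensorProduct.includeRight (R := α.invariants) (A := S) (B := S)).toRingHom)
  let Ψ : Spec (.of (S ⊗[k] A)) ⟶ Spec (.of (S ⊗[α.invariants] S)) :=
    Spec.map (CommRingCat.ofHom α.galoisMap)
  ∃ V : (Spec (.of S)).Opens,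
    (∀ q : PrimeSpectrum S, q ∉ V → 2 ≤ q.asIdeal.height) ∧
    a ⁻¹ᵁ V = pr ⁻¹ᵁ V ∧
    CategoryTheory.IsIso (Ψ ∣_ (pr₁ ⁻¹ᵁ V ⊓ pr₂ ⁻¹ᵁ V))

end Free

end GroupSchemeAction

end

/-! Normality of `R = S^G`: a fraction `a/b` of invariants that is integral over `R` lies in the
normal ring `S`, say `a = b s`. As `S ⊗ A` is torsion-free over `S`, the invariance of `b` and `b s`
forces that of `s` (`mem_invariants_of_mul_mem`).

The isomorphism: `End_R(S)` is `Hom_S(S ⊗_R S, S)` by base change, and `S # H` is `Hom_S(S ⊗_k A,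
S)` because `A` is finite-dimensional. Under these identifications the natural map is precomposition
with the Galois map `Γ : S ⊗_R S → S ⊗_k A` (`liftBaseChange_toEnd`). Linear forms with values in a
Noetherian normal domain are determined in codimension one, so it suffices that `Γ` is surjective
locally at the primes of `S` of height at most one and has torsion kernel
(`LinearMap.bijective_lcomp_of_height_le_one`).

Freeness gives bijectivity of `Γ` only over `V ×_{Spec R} V`, where both contractions to `S` must
lie in `V`, whereas localizing the `S`-module `S ⊗_R S` controls the left contraction alone. Both
contractions lie over the same prime of `R`. Since `S` is integral over `R`
(`isIntegral_invariants`, by characteristic polynomials) and `R` is normal, going down holds, so the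
two contractions have equal height and the right one is in `V` as well (`exists_tmul_one_mem`). -/

noncomputable section

/-! ### Power series rings over a field are normal -/

/-- A commutative ring `A` is completely integrally closed if every fraction `f / g` all of whose
powers have a common denominator lies in `A`. -/
def IsCompletelyIntegrallyClosed (A : Type*) [CommRing A] : Prop :=
  ∀ f g d : A, g ≠ 0 → d ≠ 0 → (∀ n : ℕ, g ^ n ∣ d * f ^ n) → g ∣ f

namespace IsCompletelyIntegrallyClosed

theorem of_field (k : Type*) [Field k] : IsCompletelyIntegrallyClosed k :=
  fun _ _ _ hg _ _ => (isUnit_iff_ne_zero.2 hg).dvd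

theorem of_ringEquiv {A B : Type*} [CommRing A] [CommRing B] (e : A ≃+* B)
    (hA : IsCompletelyIntegrallyClosed A) : IsCompletelyIntegrallyClosed B := by
  intro f g d hg hd h
  refine (map_dvd_iff e.symm).1 (hA _ _ (e.symm d) (by simpa) (by simpa) fun n => ?_)
  simpa using map_dvd e.symm (h n)

/-- Subtracting a multiple of the denominator preserves almost integrality. -/
theorem pow_dvd_mul_sub_pow {A : Type*} [CommRing A] {f g d : A}
    (h : ∀ n : ℕ, g ^ n ∣ d * f ^ n) (c : A) (n : ℕ) : g ^ n ∣ d * (f - g * c) ^ n := by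
  rw [sub_eq_add_neg, add_pow, Finset.mul_sum]
  refine Finset.dvd_sum fun i hi => ?_
  obtain ⟨y, hy⟩ := h i
  have hin : i + (n - i) = n := by have := Finset.mem_range.1 hi; omega
  refine ⟨y * (-c) ^ (n - i) * n.choose i, ?_⟩
  calc d * (f ^ i * (-(g * c)) ^ (n - i) * n.choose i)
      = (d * f ^ i) * (g * -c) ^ (n - i) * n.choose i := by rw [mul_neg]; ring
    _ = g ^ (i + (n - i)) * (y * (-c) ^ (n - i) * n.choose i) := by rw [hy, mul_pow, pow_add]; ring
    _ = _ := by rw [hin]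

-- When `X` divides neither `g` nor `d`, the quotient `f / g` is found one coefficient at a time:
-- constant terms give the first coefficient, and the remainder divided by `X` is again almost
-- integral with the same `d`. The general case follows by splitting off powers of `X`.
open PowerSeries in
theorem powerSeries {A : Type*} [CommRing A] [IsDomain A] (hA : IsCompletelyIntegrallyClosed A) :
    IsCompletelyIntegrallyClosed A⟦X⟧ := by
  have key : ∀ f g d : A⟦X⟧, ¬ X ∣ g → ¬ X ∣ d → (∀ n : ℕ, g ^ n ∣ d * f ^ n) → g ∣ f := by
    intro f g d hg hd hf
    have step : ∀ f : {f : A⟦X⟧ // ∀ n : ℕ, g ^ n ∣ d * f ^ n}, ∃ c : A,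
        ∃ f' : {f : A⟦X⟧ // ∀ n : ℕ, g ^ n ∣ d * f ^ n}, f.1 = g * C c + X * f'.1 := by
      intro ⟨f, hf⟩
      rw [X_dvd_iff] at hg hd
      obtain ⟨c, hc⟩ := hA (constantCoeff f) (constantCoeff g) (constantCoeff d) hg hd fun n => by
        simpa using map_dvd (constantCoeff (R := A)) (hf n)
      obtain ⟨f', hf'⟩ : X ∣ f - g * C c := by
        rw [X_dvd_iff]
        simp [hc]
      refine ⟨c, ⟨f', fun n => ?_⟩, by rw [← hf']; ring⟩
      obtain ⟨y, hy⟩ := pow_dvd_mul_sub_pow hf (C c) n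
      -- Here `g ^ n * y = X ^ n * (d * f' ^ n)` and `X` is a prime not dividing `g`, so `X ^ n` can
      -- be cancelled.
      have hXy : X ^ n ∣ y := by
        refine X_prime.pow_dvd_of_dvd_mul_left n (a := g ^ n) ?_ ⟨d * f' ^ n, ?_⟩
        · rw [X_dvd_iff, map_pow]
          exact pow_ne_zero _ hg
        · rw [← hy, hf']
          ring
      obtain ⟨z, rfl⟩ := hXy
      refine ⟨z, mul_left_cancel₀ (pow_ne_zero n X_ne_zero) ?_⟩
      rw [hf'] at hy
      linear_combination hy
    choose c next hnext using step
    let F : ℕ → {f : A⟦X⟧ // ∀ n : ℕ, g ^ n ∣ d * f ^ n} := fun n => next^[n] ⟨f, hf⟩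
    have hF : ∀ i, (F i).1 = g * C (c (F i)) + X * (F (i + 1)).1 := fun i => by
      simp only [F, Function.iterate_succ_apply']
      exact hnext _
    -- The error of the expansion started at stage `i` is `X` times the error started at stage `i +
    -- 1`; hence the induction is over all `i` at once.
    have hX : ∀ N i, X ^ N ∣ (F i).1 - g * PowerSeries.mk fun j => c (F (i + j)) := by
      intro N
      induction N with
      | zero => simp
      | succ N ih =>
        intro i
        have hmk : (PowerSeries.mk fun j => c (F (i + j))) =
            C (c (F i)) + X * PowerSeries.mk fun j => c (F (i + 1 + j)) := by
          ext n
          cases n with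
          | zero => simp
          | succ n => simp [coeff_succ_X_mul, add_assoc, add_comm 1 n]
        obtain ⟨y, hy⟩ := ih (i + 1)
        refine ⟨y, ?_⟩
        rw [hmk, hF i, pow_succ]
        linear_combination X * hy
    refine ⟨PowerSeries.mk fun j => c (F (0 + j)), sub_eq_zero.1 ?_⟩
    ext n
    exact X_pow_dvd_iff.1 (hX (n + 1) 0) n n.lt_succ_self
  have decomp : ∀ f : A⟦X⟧, f ≠ 0 → ∃ (n : ℕ) (u : A⟦X⟧), f = X ^ n * u ∧ ¬ X ∣ u := fun f hf =>
    ⟨_, divXPowOrder f, X_pow_order_mul_divXPowOrder.symm, by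
      rw [X_dvd_iff, constantCoeff_divXPowOrder_eq_zero_iff]
      exact hf⟩
  intro f g d hg hd h
  by_cases hf : f = 0
  · simp [hf]
  obtain ⟨l, f, rfl, hf'⟩ := decomp f hf
  obtain ⟨m, g, rfl, hg'⟩ := decomp g hg
  obtain ⟨e, d, rfl, hd'⟩ := decomp d hd
  have hndvd : ∀ {a : A⟦X⟧} (n : ℕ), ¬ X ∣ a → ¬ X ∣ a ^ n := fun n ha hn =>
    ha (X_prime.dvd_of_dvd_pow hn)
  have hml : m ≤ l := by
    -- Comparing `X`-orders at the exponent `e + 1` gives `m (e + 1) ≤ e + l (e + 1)`. This exponent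
    -- exceeds the order `e` of the denominator, so `m > l` is impossible.
    have h1 : (X : A⟦X⟧) ^ (m * (e + 1)) ∣ X ^ (e + l * (e + 1)) := by
      refine X_prime.pow_dvd_of_dvd_mul_left _ (a := d * f ^ (e + 1)) ?_ ?_
      · exact X_prime.not_dvd_mul hd' (hndvd _ hf')
      · refine (Dvd.intro (g ^ (e + 1)) ?_).trans ((h (e + 1)).trans (dvd_of_eq ?_)) <;> ring
    have h2 := (pow_dvd_pow_iff X_ne_zero X_prime.not_isUnit).1 h1
    by_contra hlt
    have := Nat.mul_le_mul_right (e + 1) (not_le.1 hlt)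
    rw [Nat.succ_mul] at this
    omega
  refine mul_dvd_mul (pow_dvd_pow X hml) (key f g d hg' hd' fun n => ?_)
  obtain ⟨y, hy⟩ : g ^ n ∣ X ^ (e + l * n) * (d * f ^ n) :=
    (Dvd.intro_left (X ^ (m * n)) (by ring)).trans ((h n).trans (dvd_of_eq (by ring)))
  obtain ⟨z, rfl⟩ := X_prime.pow_dvd_of_dvd_mul_left (e + l * n) (hndvd n hg') ⟨_, hy.symm⟩
  refine ⟨z, mul_left_cancel₀ (pow_ne_zero (e + l * n) X_ne_zero) ?_⟩
  linear_combination hy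

instance _root_.MvPowerSeries.instIsDomain (σ k : Type*) [Field k] :
    IsDomain (MvPowerSeries σ k) :=
  NoZeroDivisors.to_isDomain _

theorem mvPowerSeries_fin (k : Type*) [Field k] (n : ℕ) :
    IsCompletelyIntegrallyClosed (MvPowerSeries (Fin n) k) := by
  induction n with
  | zero => exact (of_field k).of_ringEquiv (MvPowerSeries.isEmptyEquiv (Fin 0) k).symm.toRingEquiv
  | succ n ih => exact ih.powerSeries.of_ringEquiv (MvPowerSeries.finSuccEquiv k n).symm.toRingEquiv

/-- Integral fractions are almost integral: their powers have a common denominator. -/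
theorem isIntegrallyClosed {A : Type*} [CommRing A] [IsDomain A]
    (hA : IsCompletelyIntegrallyClosed A) : IsIntegrallyClosed A := by
  refine (isIntegrallyClosed_iff (FractionRing A)).2 fun {x} hx => ?_
  obtain ⟨d, hd, h⟩ := hx.isAlmostIntegral
  obtain ⟨f, g, rfl⟩ := IsLocalization.exists_mk'_eq (nonZeroDivisors A) x
  have hg : algebraMap A (FractionRing A) g ≠ 0 :=
    IsFractionRing.to_map_ne_zero_of_mem_nonZeroDivisors g.2
  obtain ⟨c, hc⟩ := hA f g d (nonZeroDivisors.ne_zero g.2) (nonZeroDivisors.ne_zero hd) fun n => by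
    obtain ⟨y, hy⟩ := h n
    refine ⟨y, IsFractionRing.injective A (FractionRing A) ?_⟩
    rw [map_mul _ _ y, hy, Algebra.smul_def, map_mul, map_pow, map_pow,
      IsFractionRing.mk'_eq_div, div_pow]
    field_simp
  exact ⟨c, by rw [hc, IsFractionRing.mk'_eq_div, map_mul]; field_simp⟩

end IsCompletelyIntegrallyClosed

instance MvPowerSeries.isIntegrallyClosed_fin (k : Type*) [Field k] (n : ℕ) :
    IsIntegrallyClosed (MvPowerSeries (Fin n) k) :=
  (IsCompletelyIntegrallyClosed.mvPowerSeries_fin k n).isIntegrallyClosed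

/-! ### Codimension one in normal domains, and heights under going down -/

/-- In a Noetherian normal domain, divisibility can be tested at the primes of height at most
one. -/
theorem dvd_of_forall_height_le_one {S : Type*} [CommRing S] [IsDomain S] [IsNoetherianRing S]
    [IsIntegrallyClosed S] {a b : S} (hb : b ≠ 0)
    (h : ∀ q : Ideal S, q.IsPrime → q.height ≤ 1 → ∃ u ∉ q, b ∣ u * a) : b ∣ a := by
  by_contra hba
  -- The annihilator of the class of `a` in `S/b` lies in an associated prime `P = (b : c)`. Once
  -- `P` has height at most one, the hypothesis puts some `u ∉ P` in that annihilator, a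
  -- contradiction.
  obtain ⟨P, hPa, hle⟩ := exists_le_isAssociatedPrime_of_isNoetherianRing S
    (Ideal.Quotient.mk (Ideal.span {b}) a)
    (by rwa [Ne, Ideal.Quotient.eq_zero_iff_mem, Ideal.mem_span_singleton])
  obtain ⟨hP, y, hy⟩ := isAssociatedPrime_iff.1 hPa
  obtain ⟨c, rfl⟩ := Ideal.Quotient.mk_surjective y
  have hmk : ∀ s c : S, s ∈ (⊥ : Submodule S (S ⧸ Ideal.span {b})).colon
      {Ideal.Quotient.mk (Ideal.span {b}) c} ↔ b ∣ s * c := by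
    intro s c
    rw [Submodule.mem_colon_singleton, Submodule.mem_bot, Algebra.smul_def,
      Ideal.Quotient.algebraMap_eq, ← map_mul, Ideal.Quotient.eq_zero_iff_mem,
      Ideal.mem_span_singleton]
  have hmem : ∀ s, s ∈ P ↔ b ∣ s * c := fun s => by rw [hy, hmk]
  have hbc : ¬ b ∣ c := fun hbc => hP.ne_top ((Ideal.eq_top_iff_one P).2 (by simpa [hmem]))
  suffices hheight : P.height ≤ 1 by
    obtain ⟨u, hu, hua⟩ := h P hP hheight
    exact hu (hle ((hmk u a).2 hua))
  -- The dichotomy is whether `(c/b) P ⊆ P`. If not, `P` is generated by `t` after localizing at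
  -- `P`, and Krull's principal ideal theorem applies. If so, `c/b` is integral over `S`, as `P` is
  -- nonzero and finitely generated, so `b ∣ c`.
  by_cases ht : ∃ t ∈ P, ∃ w ∉ P, t * c = b * w
  · obtain ⟨t, htP, w, hw, htw⟩ := ht
    refine Ideal.height_le_one_of_isPrincipal_of_mem_minimalPrimes (Ideal.span {t}) P
      ⟨⟨hP, (Ideal.span_singleton_le_iff_mem P).2 htP⟩, fun Q ⟨hQ, htQ⟩ hQP s hs => ?_⟩
    obtain ⟨v, hv⟩ := (hmem s).1 hs
    have hsw : s * w = v * t :=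
      mul_left_cancel₀ hb (by linear_combination (-s) * htw + t * hv)
    refine (hQ.mem_or_mem (?_ : s * w ∈ Q)).resolve_right fun hwQ => hw (hQP hwQ)
    rw [hsw]
    exact Q.mul_mem_left v ((Ideal.span_singleton_le_iff_mem Q).1 htQ)
  · push Not at ht
    exfalso
    have hbK : algebraMap S (FractionRing S) b ≠ 0 := by simpa
    have hint : IsIntegral S (algebraMap S (FractionRing S) c / algebraMap S (FractionRing S) b) := by
      refine isIntegral_of_smul_mem_submodule (Submodule.map (Algebra.linearMap S (FractionRing S)) P) ?_
        ((IsNoetherian.noetherian P).map _) _ ?_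
      · refine (Submodule.ne_bot_iff _).2 ⟨_, Submodule.mem_map_of_mem ((hmem b).2 ⟨c, rfl⟩), hbK⟩
      · rintro _ ⟨s, hs, rfl⟩
        obtain ⟨v, hv⟩ := (hmem s).1 hs
        refine ⟨v, by_contra fun hvP => ht s hs v hvP hv, ?_⟩
        have := congrArg (algebraMap S (FractionRing S)) hv
        simp only [map_mul] at this
        simp only [Algebra.linearMap_apply, smul_eq_mul]
        field_simp
        linear_combination -this
    obtain ⟨z, hz⟩ := (isIntegrallyClosed_iff (FractionRing S)).1 inferInstance hint
    refine hbc ⟨z, IsFractionRing.injective S (FractionRing S) ?_⟩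
    rw [map_mul, hz, mul_div_cancel₀ _ hbK]

/-- In an integral extension with going down, primes with the same contraction have the same
height. -/
theorem Ideal.height_le_height_of_under_eq {R S : Type*} [CommRing R] [CommRing S] [Algebra R S]
    [Algebra.IsIntegral R S] [Algebra.HasGoingDown R S] {P Q : Ideal S} [hP : P.IsPrime]
    [hQ : Q.IsPrime] (h : P.under R = Q.under R) : P.height ≤ Q.height := by
  rw [(⟨P, hP⟩ : PrimeSpectrum S).height_eq_orderHeight,
    (⟨Q, hQ⟩ : PrimeSpectrum S).height_eq_orderHeight]
  refine Order.height_le fun l hl => ?_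
  -- A chain ending at `P` contracts to a strict chain by incomparability, and going down lifts it
  -- to a chain of the same length ending at `Q`.
  let l' : LTSeries (PrimeSpectrum R) := l.map (PrimeSpectrum.comap (algebraMap R S))
    fun I J hIJ => by
      obtain ⟨x, hxJ, hxI⟩ := SetLike.exists_of_lt
        ((PrimeSpectrum.asIdeal_lt_asIdeal I J).2 hIJ)
      exact Ideal.comap_lt_comap_of_integral_mem_sdiff hIJ.le ⟨hxJ, hxI⟩
        (Algebra.IsIntegral.isIntegral x)
  have : Q.LiesOver l'.last.asIdeal := ⟨by
    rw [← h, show l'.last = _ from LTSeries.last_map _ _ _, hl]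
    rfl⟩
  obtain ⟨L, hlen, hlast, -⟩ := Ideal.exists_ltSeries_of_hasGoingDown l' Q
  have h1 := Order.length_le_height hlast.le
  rwa [hlen] at h1

/-! ### Characteristic polynomials under base change and translation -/

section Charpoly

variable {k A S T : Type*} [Field k] [CommRing A] [Algebra k A] [Module.Finite k A]
  [CommRing S] [Algebra k S] [CommRing T] [Algebra k T]

theorem Algebra.TensorProduct.charpoly_lmul_map (g : S →ₐ[k] T) (x : S ⊗[k] A) :
    (Algebra.lmul T (T ⊗[k] A) (Algebra.TensorProduct.map g (AlgHom.id k A) x)).charpoly =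
      (Algebra.lmul S (S ⊗[k] A) x).charpoly.map g.toRingHom := by
  let b := Module.Free.chooseBasis k A
  have hrepr : ∀ (y : S ⊗[k] A) i, (Algebra.TensorProduct.basis T b).repr
      (Algebra.TensorProduct.map g (AlgHom.id k A) y) i =
        g ((Algebra.TensorProduct.basis S b).repr y i) := by
    intro y i
    induction y with
    | zero => simp
    | add y z hy hz => simp only [map_add, Finsupp.add_apply, hy, hz]
    | tmul s a => simp
  rw [← LinearMap.charpoly_toMatrix _ (Algebra.TensorProduct.basis T b),
    ← LinearMap.charpoly_toMatrix _ (Algebra.TensorProduct.basis S b), ← Matrix.charpoly_map]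
  congr 1
  ext i j
  refine (LinearMap.toMatrix_apply _ _ _ _ _).trans (Eq.trans ?_ ((hrepr _ i).trans
    (congrArg g (LinearMap.toMatrix_apply _ _ _ i j).symm)))
  simp

end Charpoly


section Translate

variable {k A T : Type*} [Field k] [CommRing A] [HopfAlgebra k A] [CommRing T] [Algebra k T]

namespace HopfAlgebra

/-- Translation by a `T`-point `f` of the group scheme `Spec A`, acting on `T ⊗ A` by
`b ↦ ∑ f(b₁) ⊗ b₂`. -/
def translate (f : A →ₐ[k] T) : T ⊗[k] A →ₐ[T] T ⊗[k] A :=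
  Algebra.TensorProduct.lift (Algebra.ofId T _)
    ((Algebra.TensorProduct.map f (AlgHom.id k A)).comp (Bialgebra.comulAlgHom k A))
    fun _ _ => .all _ _

theorem translate_tmul (f : A →ₐ[k] T) (t : T) (a : A) : translate f (t ⊗ₜ a) =
    t • TensorProduct.map f.toLinearMap LinearMap.id (Coalgebra.comul a) := by
  simp only [translate, Algebra.TensorProduct.lift_tmul, Algebra.smul_def]
  rfl

/-- By coassociativity, translating by `g` and then by `f` is translating by their convolution
product, here the identity point. -/
theorem translate_comp_of_convMul_eq_one (f g : A →ₐ[k] T)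
    (h : LinearMap.mul' k T ∘ₗ TensorProduct.map g.toLinearMap f.toLinearMap ∘ₗ Coalgebra.comul =
      Algebra.linearMap k T ∘ₗ Coalgebra.counit) :
    (translate f).comp (translate g) = AlgHom.id T _ := by
  let Φ : A ⊗[k] (A ⊗[k] A) →ₗ[k] T ⊗[k] A :=
    TensorProduct.map (LinearMap.mul' k T ∘ₗ TensorProduct.map g.toLinearMap f.toLinearMap)
      LinearMap.id ∘ₗ (TensorProduct.assoc k A A A).symm.toLinearMap
  have h1 : ∀ x : A ⊗[k] A, translate f (TensorProduct.map g.toLinearMap LinearMap.id x) =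
      Φ (Coalgebra.comul.lTensor A x) := by
    intro x
    induction x with
    | zero => simp
    | add x y hx hy => simp only [map_add, hx, hy]
    | tmul a b =>
      simp only [TensorProduct.map_tmul, translate_tmul, LinearMap.lTensor_tmul, LinearMap.id_apply]
      induction (Coalgebra.comul b : A ⊗[k] A) with
      | zero => simp
      | add x y hx hy => simp only [map_add, smul_add, TensorProduct.tmul_add, hx, hy]
      | tmul c d => simp [Φ, TensorProduct.smul_tmul']
  ext a
  change translate f (translate g (1 ⊗ₜ a)) = 1 ⊗ₜ a
  rw [translate_tmul, one_smul, h1, ← Coalgebra.coassoc_apply]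
  have h2 : ∀ x : A ⊗[k] A, Φ (TensorProduct.assoc k A A A (Coalgebra.comul.rTensor A x)) =
      TensorProduct.map (Algebra.linearMap k T) LinearMap.id (Coalgebra.counit.rTensor A x) := by
    intro x
    induction x with
    | zero => simp
    | add x y hx hy => simp only [map_add, hx, hy]
    | tmul a b => simpa [Φ] using congrArg (· ⊗ₜ[k] b) (LinearMap.congr_fun h a)
  rw [h2, Coalgebra.rTensor_counit_comul]
  simp

/-- Translation by a point, as an automorphism. -/
def translateEquiv (f : A →ₐ[k] T) : T ⊗[k] A ≃ₐ[T] T ⊗[k] A :=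
  AlgEquiv.ofAlgHom (translate f) (translate (f.comp (antipodeAlgHom k A)))
    (translate_comp_of_convMul_eq_one _ _ <| by
      ext a
      have h := congrArg f (mul_antipode_rTensor_comul_apply (R := k) a)
      rw [AlgHom.commutes] at h
      refine Eq.trans ?_ h
      change LinearMap.mul' k T (TensorProduct.map _ _ (Coalgebra.comul a)) = _
      induction (Coalgebra.comul a : A ⊗[k] A) with
      | zero => simp
      | add x y hx hy => simp only [map_add, hx, hy]
      | tmul b c => simp)
    (translate_comp_of_convMul_eq_one _ _ <| by
      ext a
      have h := congrArg f (mul_antipode_lTensor_comul_apply (R := k) a)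
      rw [AlgHom.commutes] at h
      refine Eq.trans ?_ h
      change LinearMap.mul' k T (TensorProduct.map _ _ (Coalgebra.comul a)) = _
      induction (Coalgebra.comul a : A ⊗[k] A) with
      | zero => simp
      | add x y hx hy => simp only [map_add, hx, hy]
      | tmul b c => simp)

theorem translateEquiv_apply (f : A →ₐ[k] T) (x : T ⊗[k] A) :
    translateEquiv f x = translate f x := rfl

end HopfAlgebra

theorem AlgEquiv.charpoly_lmul {R B C : Type*} [CommRing R] [CommRing B] [CommRing C] [Algebra R B]
    [Algebra R C] [Module.Finite R B] [Module.Free R B] [Module.Finite R C] [Module.Free R C]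
    (e : B ≃ₐ[R] C) (b : B) : (Algebra.lmul R C (e b)).charpoly = (Algebra.lmul R B b).charpoly := by
  rw [← LinearEquiv.charpoly_conj e.toLinearEquiv]
  congr 1
  ext c
  simp [LinearEquiv.conj_apply]

end Translate

/-! ### The ring of invariants: normality and integrality of `S` over it -/

namespace GroupSchemeAction
variable {k A S : Type*} [Field k] [CommRing A] [HopfAlgebra k A] [CommRing S] [Algebra k S]
  (α : GroupSchemeAction k A S)

/-- The difference `ρ(s) - s ⊗ 1` is killed by `b`, and `S ⊗ A` is free over the domain `S`. -/
theorem mem_invariants_of_mul_mem [IsDomain S] {b s : S} (hb0 : b ≠ 0) (hb : b ∈ α.invariants)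
    (hbs : b * s ∈ α.invariants) : s ∈ α.invariants := by
  rw [mem_invariants] at *
  have h : b • (α.coaction s - s ⊗ₜ 1) = 0 := by
    rw [map_mul, hb] at hbs
    rw [smul_sub, TensorProduct.smul_tmul', smul_eq_mul, ← hbs, Algebra.smul_def]
    simp
  exact sub_eq_zero.1 ((smul_eq_zero_iff_right hb0).1 h)

theorem isIntegrallyClosed_invariants [IsDomain S] [IsIntegrallyClosed S] :
    IsIntegrallyClosed α.invariants := by
  refine (isIntegrallyClosed_iff (FractionRing α.invariants)).2 fun {x} hx => ?_
  have hinj : Function.Injective (algebraMap α.invariants S) := Subtype.val_injective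
  obtain ⟨a, b, rfl⟩ := IsLocalization.exists_mk'_eq (nonZeroDivisors α.invariants) x
  have hb : (b : S) ≠ 0 := fun h => nonZeroDivisors.ne_zero b.2 (Subtype.ext h)
  let f : FractionRing α.invariants →+* FractionRing S := IsFractionRing.map hinj
  have hf : IsIntegral S (f (IsLocalization.mk' _ a b)) :=
    hx.map_of_comp_eq (algebraMap α.invariants S) f (by
      ext r
      simp [f, IsFractionRing.map])
  obtain ⟨s, hs⟩ := (isIntegrallyClosed_iff (FractionRing S)).1 inferInstance hf
  have hbs : (b : S) * s = a := by
    apply IsFractionRing.injective S (FractionRing S)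
    rw [map_mul, hs]
    have := congrArg f (IsLocalization.mk'_spec' (FractionRing α.invariants) a b)
    simpa [f, IsFractionRing.map] using this
  refine ⟨⟨s, α.mem_invariants_of_mul_mem hb b.1.2 (hbs ▸ a.2)⟩, ?_⟩
  rw [eq_comm, IsLocalization.mk'_eq_iff_eq_mul, ← map_mul, mul_comm]
  exact congrArg _ (Subtype.ext hbs.symm)

section Integral

variable [Module.Finite k A]

/-- The characteristic polynomial of the multiplication by `ρ(s)` on the free `S`-module `S ⊗ A`,
where `ρ` is the coaction. -/
def orbitPoly (s : S) : Polynomial S := (Algebra.lmul S (S ⊗[k] A) (α.coaction s)).charpoly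

theorem orbitPoly_monic (s : S) : (α.orbitPoly s).Monic := LinearMap.charpoly_monic _

/-- The base changes of `ρ(s)` along `ρ` and along the inclusion `S → S ⊗ A` correspond under
translation by the universal point of `Spec A`; this is coassociativity. Characteristic polynomials
are unchanged by automorphisms, so `ρ` and the inclusion agree on the coefficients. -/
theorem orbitPoly_coeff_mem (s : S) (i : ℕ) : (α.orbitPoly s).coeff i ∈ α.invariants := by
  let j : A →ₐ[k] S ⊗[k] A := Algebra.TensorProduct.includeRight
  let ι : S →ₐ[k] S ⊗[k] A := Algebra.TensorProduct.includeLeft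
  have h1 : ∀ x : S ⊗[k] A,
      HopfAlgebra.translate j (Algebra.TensorProduct.map ι (AlgHom.id k A) x) =
        (TensorProduct.assoc k S A A).symm
          (TensorProduct.map LinearMap.id Coalgebra.comul x) := by
    intro x
    induction x with
    | zero => simp
    | add x y hx hy => simp only [map_add, hx, hy]
    | tmul s a =>
      simp only [Algebra.TensorProduct.map_tmul, HopfAlgebra.translate_tmul, AlgHom.id_apply,
        TensorProduct.map_tmul, LinearMap.id_apply]
      induction (Coalgebra.comul a : A ⊗[k] A) with
      | zero => simp
      | add x y hx hy => simp only [map_add, smul_add, TensorProduct.tmul_add, hx, hy]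
      | tmul c d => simp [j, ι, TensorProduct.smul_tmul']
  have h2 : HopfAlgebra.translateEquiv j (Algebra.TensorProduct.map ι
      (AlgHom.id k A) (α.coaction s)) =
        Algebra.TensorProduct.map α.coaction (AlgHom.id k A) (α.coaction s) := by
    rw [HopfAlgebra.translateEquiv_apply, h1, ← α.coassoc, LinearEquiv.symm_apply_apply]
    rfl
  have h3 := (HopfAlgebra.translateEquiv j).charpoly_lmul (Algebra.TensorProduct.map ι
      (AlgHom.id k A) (α.coaction s))
  rw [h2, Algebra.TensorProduct.charpoly_lmul_map, Algebra.TensorProduct.charpoly_lmul_map] at h3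
  have h4 := congrArg (fun p => Polynomial.coeff p i) h3
  simp only [Polynomial.coeff_map] at h4
  exact h4

/-- Cayley–Hamilton makes `ρ(s)` a root; the counit of `A` carries `ρ(s)` to `s`. -/
theorem orbitPoly_eval (s : S) : (α.orbitPoly s).eval s = 0 := by
  let ε : S ⊗[k] A →ₐ[S] S := (Algebra.TensorProduct.rid k S S).toAlgHom.comp
    (Algebra.TensorProduct.map (AlgHom.id S S) (Bialgebra.counitAlgHom k A))
  have hε : ε (α.coaction s) = s := α.counital s
  have h := LinearMap.aeval_self_charpoly (Algebra.lmul S (S ⊗[k] A) (α.coaction s))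
  rw [Polynomial.aeval_algHom_apply] at h
  have h2 := congrArg ε (LinearMap.congr_fun h 1)
  change ε (Polynomial.aeval (α.coaction s) (α.orbitPoly s) * 1) = ε 0 at h2
  rwa [mul_one, ← Polynomial.aeval_algHom_apply, hε, map_zero, Polynomial.coe_aeval_eq_eval] at h2

instance isIntegral_invariants : Algebra.IsIntegral α.invariants S where
  isIntegral s := by
    have h : α.orbitPoly s ∈ Polynomial.lifts (algebraMap α.invariants S) :=
      (Polynomial.lifts_iff_coeff_lifts _).2 fun i => ⟨⟨_, α.orbitPoly_coeff_mem s i⟩, rfl⟩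
    obtain ⟨q, hq, -, hmonic⟩ :=
      Polynomial.lifts_and_natDegree_eq_and_monic h (α.orbitPoly_monic s)
    refine ⟨q, hmonic, ?_⟩
    rw [← Polynomial.eval_map, hq, orbitPoly_eval]

end Integral

end GroupSchemeAction

/-! ### From an isomorphism over an open subset to localized rings -/

section AffineMorphisms

open AlgebraicGeometry CategoryTheory

theorem isIso_app_image {X Y : Scheme.{u}} (f : X ⟶ Y) (W : Y.Opens) [IsIso (f ∣_ W)]
    (V : W.toScheme.Opens) : IsIso (f.app (W.ι ''ᵁ V)) := by
  have h : IsIso ((f ∣_ W).app V) := inferInstance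
  rw [morphismRestrict_app] at h
  have h' : IsIso (X.presheaf.map (eqToHom (image_morphismRestrict_preimage f W V)).op) :=
    inferInstance
  exact @IsIso.of_isIso_comp_right _ _ _ _ _ _ _ h' h

theorem app_algebraMap {B C : CommRingCat.{u}} (φ : B ⟶ C) (D : (Spec B).Opens) (y : B) :
    (Spec.map φ).app D (algebraMap B Γ(Spec B, D) y) =
      algebraMap C Γ(Spec C, (Spec.map φ) ⁻¹ᵁ D) (φ y) :=
  ConcreteCategory.congr_hom (StructureSheaf.toOpen_comp_comap φ.hom D) y

/-- If `Spec C → Spec B` is an isomorphism over an open subset containing `D(b)`, then `B → C` becomes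
an isomorphism after inverting `b`. -/
theorem bijective_away_of_isIso_morphismRestrict {B C : CommRingCat.{u}} (φ : B ⟶ C)
    (W : (Spec B).Opens) [IsIso (Spec.map φ ∣_ W)] (b : B)
    (hb : PrimeSpectrum.basicOpen b ≤ W) :
    (∀ c : C, ∃ (n : ℕ) (y : B), c * φ b ^ n = φ y) ∧ ∀ y : B, φ y = 0 → ∃ n : ℕ, b ^ n * y = 0 := by
  obtain ⟨D, hD⟩ : ∃ D : (Spec B).Opens, D = PrimeSpectrum.basicOpen b := ⟨_, rfl⟩
  have hDW : W.ι ''ᵁ (W.ι ⁻¹ᵁ D) = D := by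
    have : D ≤ W := by rw [hD]; exact hb
    rw [Scheme.Hom.image_preimage_eq_opensRange_inf]
    simpa using this
  have h1 := isIso_app_image (Spec.map φ) W (W.ι ⁻¹ᵁ D)
  rw [hDW] at h1
  -- On sections over `D = D(b)` the morphism is the map of localizations `B_b → C_{φ(b)}`, which is
  -- therefore bijective; it remains to clear denominators.
  obtain ⟨hinj, hsurj⟩ := ConcreteCategory.bijective_of_isIso ((Spec.map φ).app D)
  have hlB : IsLocalization.Away b Γ(Spec B, D) := by
    subst hD
    exact IsAffineOpen.instAwayCarrierObjOppositeOpensCarrierCarrierCommRingCatSpecPresheafOpOpensBasicOpen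
  have hlC : IsLocalization.Away (φ b) Γ(Spec C, (Spec.map φ) ⁻¹ᵁ D) := by
    subst hD
    exact IsAffineOpen.instAwayCarrierObjOppositeOpensCarrierCarrierCommRingCatSpecPresheafOpOpensBasicOpen (f := φ b)
  constructor
  · intro c
    obtain ⟨z, hz⟩ := hsurj (algebraMap C _ c)
    obtain ⟨n, y, hy⟩ := IsLocalization.Away.surj b z
    have h2 := congrArg ((Spec.map φ).app D) hy
    rw [map_mul, map_pow, app_algebraMap, app_algebraMap, hz, ← map_pow, ← map_mul] at h2
    obtain ⟨⟨_, m, rfl⟩, hm⟩ := (IsLocalization.eq_iff_exists (.powers (φ b)) _).1 h2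
    refine ⟨m + n, b ^ m * y, ?_⟩
    rw [map_mul, map_pow, ← hm, pow_add]
    ring
  · intro y hy
    have h2 : algebraMap B Γ(Spec B, D) y = 0 := hinj (by rw [app_algebraMap, hy, map_zero, map_zero])
    obtain ⟨⟨_, m, rfl⟩, hm⟩ := (IsLocalization.map_eq_zero_iff (.powers b) _ _).1 h2
    exact ⟨m, hm⟩

end AffineMorphisms

/-! ### Linear forms are determined in codimension one -/

/-- Let `Γ : M → N` be a linear map over a Noetherian normal domain that becomes surjective at all
primes of height at most one and injective at the generic point. Then every linear form on `M`
factors uniquely through `Γ`. -/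
theorem LinearMap.bijective_lcomp_of_height_le_one {S M N : Type*} [CommRing S] [IsDomain S]
    [IsNoetherianRing S] [IsIntegrallyClosed S] [AddCommGroup M] [Module S M] [AddCommGroup N]
    [Module S N] (Γ : M →ₗ[S] N)
    (hsurj : ∀ q : Ideal S, q.IsPrime → q.height ≤ 1 → ∀ z : N, ∃ u ∉ q, ∃ y, Γ y = u • z)
    (hinj : ∀ y : M, Γ y = 0 → ∃ u : S, u ≠ 0 ∧ u • y = 0) :
    Function.Bijective fun Φ : N →ₗ[S] S => Φ ∘ₗ Γ := by
  have hgen : ∀ z : N, ∃ u : S, u ≠ 0 ∧ ∃ y, Γ y = u • z := hsurj ⊥ Ideal.isPrime_bot (by simp)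
  refine ⟨fun Φ Ψ h => LinearMap.ext fun z => ?_, fun φ => ?_⟩
  · obtain ⟨u, hu, y, hy⟩ := hgen z
    have := LinearMap.congr_fun h y
    simp only [LinearMap.comp_apply, hy, map_smul, smul_eq_mul] at this
    exact mul_left_cancel₀ hu this
  have hker : ∀ y y' : M, Γ y = Γ y' → φ y = φ y' := by
    intro y y' h
    obtain ⟨u, hu, huy⟩ := hinj (y - y') (by rw [map_sub, h, sub_self])
    have := congrArg φ huy
    rw [map_smul, map_zero, smul_eq_mul, map_sub] at this
    exact sub_eq_zero.1 ((mul_eq_zero.1 this).resolve_left hu)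
  -- The value at `z` has to be `c = φ(y) / u` whenever `Γ y = u z`. One pair defines it, by
  -- divisibility in codimension one; recording all pairs lets linearity be checked on convenient
  -- ones.
  have hex : ∀ z : N, ∃ c : S, ∀ (u : S) (y : M), Γ y = u • z → φ y = u * c := by
    intro z
    obtain ⟨u, hu, y, hy⟩ := hgen z
    have hcross : ∀ (v : S) (y' : M), Γ y' = v • z → v * φ y = u * φ y' := by
      intro v y' hy'
      have := hker (v • y) (u • y') (by rw [map_smul, map_smul, hy, hy', smul_comm])
      simpa using this
    obtain ⟨c, hc⟩ : u ∣ φ y := dvd_of_forall_height_le_one hu fun q hq hq1 => by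
      obtain ⟨v, hv, y', hy'⟩ := hsurj q hq hq1 z
      exact ⟨v, hv, φ y', hcross v y' hy'⟩
    refine ⟨c, fun v y' hy' => mul_left_cancel₀ hu ?_⟩
    rw [← hcross v y' hy', hc]
    ring
  choose F hF using hex
  refine ⟨{ toFun := F, map_add' := fun z z' => ?_, map_smul' := fun r z => ?_ }, ?_⟩
  · obtain ⟨u, hu, y, hy⟩ := hgen z
    obtain ⟨v, hv, y', hy'⟩ := hgen z'
    have h := hF (z + z') (u * v) (v • y + u • y') (by
      rw [map_add, map_smul, map_smul, hy, hy', smul_add, smul_smul, smul_smul, mul_comm v])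
    rw [map_add, map_smul, map_smul, hF z u y hy, hF z' v y' hy'] at h
    refine mul_left_cancel₀ (mul_ne_zero hu hv) (h.symm.trans ?_)
    simp only [smul_eq_mul]
    ring
  · obtain ⟨u, hu, y, hy⟩ := hgen z
    have h := hF (r • z) u (r • y) (by rw [map_smul, hy, smul_comm])
    rw [map_smul, hF z u y hy] at h
    refine mul_left_cancel₀ hu (h.symm.trans ?_)
    simp only [smul_eq_mul, RingHom.id_apply]
    ring
  · ext y
    simpa using (hF (Γ y) 1 y (one_smul _ _).symm).symm

theorem TensorProduct.tmul_one_mul {R S T : Type*} [CommRing R] [CommRing S] [CommRing T]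
    [Algebra R S] [Algebra R T] (s : S) (y : S ⊗[R] T) : s ⊗ₜ[R] (1 : T) * y = s • y := by
  induction y with
  | zero => simp
  | add x y hx hy => rw [mul_add, smul_add, hx, hy]
  | tmul t u => rw [Algebra.TensorProduct.tmul_mul_tmul, one_mul, TensorProduct.smul_tmul', smul_eq_mul]

/-! ### The natural map as precomposition with the Galois map -/

namespace GroupSchemeAction

section Hom

variable {k A S : Type*} [Field k] [CommRing A] [HopfAlgebra k A] [CommRing S] [Algebra k S]
  (α : GroupSchemeAction k A S)

/-- The map `S ⊗_R S → S ⊗_k A`, `s ⊗ t ↦ (s ⊗ 1) ρ(t)`, as an `S`-linear map. -/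
def galoisLinear : S ⊗[α.invariants] S →ₗ[S] S ⊗[k] A where
  toFun := α.galoisMap
  map_add' := map_add _
  map_smul' s y := by
    rw [← TensorProduct.tmul_one_mul, map_mul, galoisMap_tmul, map_one, mul_one, RingHom.id_apply,
      TensorProduct.tmul_one_mul]

theorem galoisLinear_apply (y : S ⊗[α.invariants] S) : α.galoisLinear y = α.galoisMap y := rfl

variable [Module.Finite k A]

/-- The identification of `S # H` with the space of `S`-linear forms on `S ⊗ A`. -/
def skewEquiv : α.SkewGroupSchemeRing ≃ₗ[k] (S ⊗[k] A →ₗ[S] S) :=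
  ModuleAlgebra.SmashProduct.toTensor α.moduleAlgebra ≪≫ₗ TensorProduct.comm k S (HopfDual k A) ≪≫ₗ
    TensorProduct.congr (HopfDual.toDual k A) (LinearEquiv.refl k S) ≪≫ₗ
    dualTensorHomEquiv k A S ≪≫ₗ (LinearMap.liftBaseChangeEquiv S).restrictScalars k

theorem skewEquiv_smash_tmul (s t : S) (f : HopfDual k A) (a : A) :
    α.skewEquiv (ModuleAlgebra.SmashProduct.smash α.moduleAlgebra s f) (t ⊗ₜ a) =
      s * slice k A S f (t ⊗ₜ a) := by
  simp [skewEquiv, ModuleAlgebra.SmashProduct.smash, mul_comm]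

/-- Both sides are `S`-linear, so it is enough to compare them on `1 ⊗ t`, where `Γ(1 ⊗ t) = ρ(t)`
and the action of `H` is evaluation of `ρ(t)` on linear forms. -/
theorem liftBaseChange_toEnd (x : α.SkewGroupSchemeRing) :
    (α.toEnd x).liftBaseChange S = α.skewEquiv x ∘ₗ α.galoisLinear := by
  have h : ∀ t, α.toEnd x t = α.skewEquiv x (α.coaction t) := by
    intro t
    induction x using ModuleAlgebra.SmashProduct.induction_on with
    | h0 => simp
    | hadd x y hx hy => simp only [map_add, LinearMap.add_apply, hx, hy]
    | hsmash s f =>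
      rw [toEnd_smash, moduleAlgebra_act]
      induction α.coaction t with
      | zero => simp
      | add x y hx hy => simp only [map_add, mul_add, hx, hy]
      | tmul t a => rw [skewEquiv_smash_tmul]
  ext t
  simp [h, galoisLinear_apply, ← Algebra.TensorProduct.one_def]

theorem toEnd_bijective_of_bijective
    (h : Function.Bijective fun Φ : S ⊗[k] A →ₗ[S] S => Φ ∘ₗ α.galoisLinear) :
    Function.Bijective α.toEnd := by
  have h1 := h.comp α.skewEquiv.bijective
  have h2 : (LinearMap.liftBaseChangeEquiv S : (S →ₗ[α.invariants] S) ≃ₗ[S] _) ∘ α.toEnd =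
      (fun Φ : S ⊗[k] A →ₗ[S] S => Φ ∘ₗ α.galoisLinear) ∘ α.skewEquiv :=
    funext α.liftBaseChange_toEnd
  rw [← h2] at h1
  exact (Function.Bijective.of_comp_iff' (LinearEquiv.bijective _) _).1 h1

end Hom

/-! ### Freeness in codimension one makes the Galois map generically injective and surjective in
codimension one -/

section Free

open AlgebraicGeometry

variable {k A S : Type u} [Field k] [CommRing A] [HopfAlgebra k A] [CommRing S] [Algebra k S]
  {α : GroupSchemeAction k A S}

/-- An ideal of `S ⊗_R S` that is contained in no prime with both contractions to `S` of height at
most one meets the complement of every prime of height at most one of the left factor. -/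
theorem exists_tmul_one_mem [IsDomain S] [IsIntegrallyClosed S] [Module.Finite k A]
    (I : Ideal (S ⊗[α.invariants] S))
    (hI : ∀ Q : Ideal (S ⊗[α.invariants] S), Q.IsPrime →
      (Q.comap Algebra.TensorProduct.includeLeftRingHom).height ≤ 1 →
      (Q.comap (Algebra.TensorProduct.includeRight (R := α.invariants) (A := S)).toRingHom).height
        ≤ 1 → ¬ I ≤ Q)
    (q : Ideal S) [q.IsPrime] (hq : q.height ≤ 1) : ∃ u ∉ q, u ⊗ₜ 1 ∈ I := by
  by_contra! h
  have := α.isIntegrallyClosed_invariants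
  -- If `I` misses all `u ⊗ 1` with `u ∉ q`, it lies in a prime `Q` missing them too. The left
  -- contraction of `Q` is then inside `q`; the right one has the same trace on `R`, as `r ⊗ 1 = 1 ⊗
  -- r`, so its height is also at most one.
  obtain ⟨Q, hQ, hIQ, hd⟩ := Ideal.exists_le_prime_disjoint I
    (q.primeCompl.map (Algebra.TensorProduct.includeLeftRingHom : S →+* S ⊗[α.invariants] S))
    (Set.disjoint_left.2 fun x hx ⟨u, hu, hux⟩ => h u hu (by subst hux; exact hx))
  have hle : Q.comap Algebra.TensorProduct.includeLeftRingHom ≤ q := fun s hs => by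
    by_contra hsq
    exact Set.disjoint_left.1 hd hs ⟨s, hsq, rfl⟩
  have h1 := (Ideal.height_mono hle).trans hq
  refine hI Q hQ h1 ((Ideal.height_le_height_of_under_eq (R := α.invariants) ?_).trans h1) hIQ
  ext r
  change (1 : S) ⊗ₜ[α.invariants] (r : S) ∈ Q ↔ (r : S) ⊗ₜ[α.invariants] (1 : S) ∈ Q
  have : (r : S) ⊗ₜ[α.invariants] (1 : S) = (1 : S) ⊗ₜ[α.invariants] (r : S) := by
    have := TensorProduct.smul_tmul (R := α.invariants) r (1 : S) (1 : S)
    simpa [Algebra.smul_def] using this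
  rw [this]

/-- Locally on the primes with both contractions of height at most one, `galoisMap` is bijective. -/
theorem FreeInCodimensionOne.exists_notMem (hα : α.FreeInCodimensionOne)
    (Q : Ideal (S ⊗[α.invariants] S)) [hQ : Q.IsPrime]
    (h1 : (Q.comap Algebra.TensorProduct.includeLeftRingHom).height ≤ 1)
    (h2 : (Q.comap (Algebra.TensorProduct.includeRight (R := α.invariants) (A := S)).toRingHom).height
        ≤ 1) :
    ∃ b ∉ Q, (∀ z : S ⊗[k] A, ∃ n y, α.galoisMap y = α.galoisMap (b ^ n) * z) ∧
      ∀ y, α.galoisMap y = 0 → ∃ n : ℕ, b ^ n * y = 0 := by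
  obtain ⟨V, hV, -, hiso⟩ := hα
  have hVmem : ∀ q : PrimeSpectrum S, q.asIdeal.height ≤ 1 → q ∈ V := fun q hq => by
    by_contra hqV
    exact absurd ((hV q hqV).trans hq) (by decide)
  set W : (Spec (.of (S ⊗[α.invariants] S))).Opens := _ ⊓ _
  have hQW : (⟨Q, hQ⟩ : PrimeSpectrum (S ⊗[α.invariants] S)) ∈ W :=
    ⟨hVmem ⟨_, inferInstance⟩ h1, hVmem ⟨_, inferInstance⟩ h2⟩
  obtain ⟨_, ⟨b, rfl⟩, hbQ, hbW⟩ :=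
    PrimeSpectrum.isTopologicalBasis_basic_opens.exists_subset_of_mem_open hQW W.isOpen
  obtain ⟨hs, hi⟩ := bijective_away_of_isIso_morphismRestrict
    (CommRingCat.ofHom α.galoisMap) W b hbW
  refine ⟨b, hbQ, fun z => ?_, hi⟩
  obtain ⟨n, y, hy⟩ := hs z
  exact ⟨n, y, by rw [map_pow, mul_comm]; exact hy.symm⟩

theorem FreeInCodimensionOne.exists_galoisLinear_eq [IsDomain S] [IsIntegrallyClosed S]
    [Module.Finite k A] (hα : α.FreeInCodimensionOne) (q : Ideal S) [q.IsPrime] (hq : q.height ≤ 1)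
    (z : S ⊗[k] A) : ∃ u ∉ q, ∃ y, α.galoisLinear y = u • z := by
  -- The ideal of multipliers that bring `z` into the image of `Γ`. It contains a power of an
  -- element outside each relevant prime `Q`, hence is not contained in `Q`.
  let I : Ideal (S ⊗[α.invariants] S) :=
    { carrier := {b | ∃ y, α.galoisMap y = α.galoisMap b * z}
      zero_mem' := ⟨0, by simp⟩
      add_mem' := fun {a b} ⟨y, hy⟩ ⟨y', hy'⟩ => ⟨y + y', by rw [map_add, hy, hy', map_add, add_mul]⟩
      smul_mem' := fun c b ⟨y, hy⟩ => ⟨c * y, by rw [map_mul, hy, smul_eq_mul, map_mul, mul_assoc]⟩ }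
  obtain ⟨u, hu, y, hy⟩ := exists_tmul_one_mem I (fun Q hQ h1 h2 hIQ => by
    obtain ⟨b, hb, hs, -⟩ := hα.exists_notMem Q h1 h2
    obtain ⟨n, hn⟩ := hs z
    exact hb (hQ.mem_of_pow_mem n (hIQ hn))) q hq
  refine ⟨u, hu, y, ?_⟩
  rw [galoisLinear_apply, hy, galoisMap_tmul, map_one, mul_one, TensorProduct.tmul_one_mul]

theorem FreeInCodimensionOne.exists_smul_eq_zero [IsDomain S] [IsIntegrallyClosed S]
    [Module.Finite k A] (hα : α.FreeInCodimensionOne) (y : S ⊗[α.invariants] S)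
    (hy : α.galoisLinear y = 0) : ∃ u : S, u ≠ 0 ∧ u • y = 0 := by
  -- The same argument for the annihilator of `y`, at the zero ideal of `S`.
  obtain ⟨u, hu, huy⟩ := exists_tmul_one_mem (LinearMap.ker (LinearMap.mulRight _ y))
    (fun Q hQ h1 h2 hIQ => by
      obtain ⟨b, hb, -, hi⟩ := hα.exists_notMem Q h1 h2
      obtain ⟨n, hn⟩ := hi y hy
      exact hb (hQ.mem_of_pow_mem n (hIQ hn))) ⊥ (by simp)
  exact ⟨u, hu, (TensorProduct.tmul_one_mul u y).symm.trans huy⟩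

end Free

end GroupSchemeAction

end

theorem proposition2p3 {k A : Type u} [Field k] [IsAlgClosed k] (p : ℕ) [Fact p.Prime] [CharP k p]
    [CommRing A] [HopfAlgebra k A] [Module.Finite k A] (n : ℕ)
    (α : GroupSchemeAction k A (MvPowerSeries (Fin n) k)) (hα : α.FreeInCodimensionOne) :
    IsIntegrallyClosed α.invariants ∧ Function.Bijective α.toEnd :=
  ⟨α.isIntegrallyClosed_invariants, α.toEnd_bijective_of_bijective <|
    LinearMap.bijective_lcomp_of_height_le_one α.galoisLinear
      (fun q _ hq => hα.exists_galoisLinear_eq q hq) hα.exists_smul_eq_zero⟩
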